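/- Let $d\ge 3$ and consider simple random walk on $\mathbb Z^d$ (nearest-neighbour steps, each with probability $\frac1{2d}$), with transition matrix $Q$. A non-trivial discrete based loop is a sequence $(x_1,\dots,x_k)$ of vertices of $\mathbb Z^d$, $k\ge 2$, with $x_1\ne x_2,\dots,x_{k-1}\ne x_k,\ x_k\ne x_1$; it is given the weight $\frac1k\,Q(x_1,x_2)\cdots Q(x_{k-1},x_k)\,Q(x_k,x_1)$. A loop is an equivalence class of based loops under circular permutation, and $\mu$ is the image on loops of this weighted measure on based loops. For $\alpha>0$ let $\mathcal L_{\alpha}=\mathcal L_{\alpha,0}$ (the case $\kappa=0$ of no killing) be a Poisson ensemble of loops of intensity $\alpha\mu$, i.e. a random countable collection of loops whose point measure is a Poisson random measure with intensity $\alpha\mu$. An edge of $\mathbb Z^d$ is open if it is traversed (in either direction) by at least one loop of $\mathcal L_\alpha$; write $0\overset{\mathcal L_\alpha}{\longleftrightarrow}A$ if some vertex of $A$ is joined to $0$ by a path of open edges. Let $B(0,n)=\{x\in\mathbb Z^d:\|x\|_\infty\le n\}$, and let $\partial B(0,n)$ be the set of vertices of $B(0,n)$ that have a neighbour outside $B(0,n)$.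 Theorem. For every $d\ge3$ there is a constant $c=c(d)>0$ such that for all $\alpha>0$ and all integers $n\ge1$, $$\mathbb P\big[0\overset{\mathcal L_{\alpha}}{\longleftrightarrow}\partial B(0,n)\big]\ \ge\ \mathbb P\big[\exists\,\ell\in\mathcal L_{\alpha}:\ \ell\text{ visits }0\text{ and visits some vertex of }\partial B(0,n)\big]\ \ge\ c\cdot\min\{1,\ \alpha\, n^{2-d}\}.$$ In particular, the lower bound is $\alpha\cdot c\cdot n^{2-d}$ whenever $\alpha\le n^{d-2}$, for instance for all $n\geq 1$ if $\alpha\le 1$. -/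

import Mathlib

open MeasureTheory ProbabilityTheory
open scoped ENNReal NNReal

noncomputable section

/-! ### The lattice and its simple random walk -/

/-- The vertices of the integer lattice. -/
abbrev ZLat (d : ℕ) : Type := Fin d → ℤ

/-- The nearest neighbour graph on `ℤ^d`: `x ~ y` iff their `ℓ¹` distance is `1`. -/
def latGraph (d : ℕ) : SimpleGraph (ZLat d) where
  Adj x y := ∑ i, |x i - y i| = 1
  symm := ⟨fun x y h => by simpa only [abs_sub_comm] using h⟩
  loopless := ⟨fun x h => by simp at h⟩

open Classical in
/-- Transition probabilities of the simple random walk on `ℤ^d`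
(every vertex has `2d` neighbours). -/
def srw (d : ℕ) (x y : ZLat d) : ℝ :=
  if (latGraph d).Adj x y then 1 / (2 * (d : ℝ)) else 0

/-- The box of side length `2n` centred at `x`. -/
def box {d : ℕ} (x : ZLat d) (n : ℕ) : Set (ZLat d) := {y | ∀ i, |y i - x i| ≤ (n : ℤ)}

/-- The (inner vertex) boundary of a set of vertices in a graph. -/
def vertexBoundary {V : Type*} (G : SimpleGraph V) (F : Set V) : Set V :=
  {x | x ∈ F ∧ ∃ y, y ∉ F ∧ G.Adj x y}

/-! ### Loops -/

/-- Non-trivial discrete based loops: sequences `(x₁, …, xₙ)`, `n ≥ 2`, with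
`x₁ ≠ x₂, …, xₙ₋₁ ≠ xₙ, xₙ ≠ x₁`. -/
def BasedLoop (V : Type*) : Type _ :=
  {l : List V // 2 ≤ l.length ∧ Cycle.Chain (fun x y => x ≠ y) (l : Cycle V)}

/-- Non-trivial discrete loops: based loops up to circular permutation. (A `Cycle` is a list
up to rotation, and `Cycle.Chain r` says that `r` holds between any two cyclically consecutive
entries.) -/
def DiscreteLoop (V : Type*) : Type _ :=
  {c : Cycle V // 2 ≤ c.length ∧ Cycle.Chain (fun x y => x ≠ y) c}

instance (V : Type*) : MeasurableSpace (BasedLoop V) := ⊤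

instance (V : Type*) : MeasurableSpace (DiscreteLoop V) := ⊤

/-- The equivalence class of a based loop. -/
def BasedLoop.toLoop {V : Type*} (b : BasedLoop V) : DiscreteLoop V := ⟨(b.1 : Cycle V), b.2⟩

/-- `ℓ.Visits x`: the loop `ℓ` visits the vertex `x`. -/
def DiscreteLoop.Visits {V : Type*} (ℓ : DiscreteLoop V) (x : V) : Prop := x ∈ ℓ.1

/-- `ℓ.Traverses x y`: the loop `ℓ` traverses the undirected edge `{x, y}`, i.e. it has a
representative starting with `x, y` or with `y, x`. -/
def DiscreteLoop.Traverses {V : Type*} (ℓ : DiscreteLoop V) (x y : V) : Prop :=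
  ∃ l : List V, ℓ.1 = ((x :: y :: l : List V) : Cycle V) ∨
    ℓ.1 = ((y :: x :: l : List V) : Cycle V)

/-- The weight `(1/n) (1/(1+κ))^n Q(x₁,x₂) ⋯ Q(xₙ₋₁,xₙ) Q(xₙ,x₁)` of `(x₁, …, xₙ)`. -/
def basedLoopWeight {V : Type*} (Q : V → V → ℝ) (κ : ℝ) (l : List V) : ℝ :=
  1 / (l.length : ℝ) * (1 / (1 + κ)) ^ l.length * (List.zipWith Q l (l.rotate 1)).prod

/-- The measure on based loops that gives each based loop its weight. -/
def basedLoopMeasure {V : Type*} (Q : V → V → ℝ) (κ : ℝ) : Measure (BasedLoop V) :=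
  Measure.sum fun b => ENNReal.ofReal (basedLoopWeight Q κ b.1) • Measure.dirac b

/-- The loop measure `μ_κ`: the push-forward of the measure on based loops. -/
def loopMeasure {V : Type*} (Q : V → V → ℝ) (κ : ℝ) : Measure (DiscreteLoop V) :=
  (basedLoopMeasure Q κ).map BasedLoop.toLoop

/-! ### Poisson ensembles -/

/-- `N` is a Poisson random measure with intensity `ν` on the probability space `(Ω, P)`:
the number of points in `A` is Poisson distributed with parameter `ν A` (infinite almost surely
if `ν A = ∞`), and the numbers of points in disjoint sets are independent. -/
structure IsPoissonRandomMeasure {Ω E : Type*} [MeasurableSpace Ω] [MeasurableSpace E]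
    (P : Measure Ω) (ν : Measure E) (N : Ω → Measure E) : Prop where
  measurable : Measurable N
  count : ∀ A, MeasurableSet A → ν A ≠ ∞ →
    P.map (fun ω => N ω A) = (poissonMeasure (ν A).toNNReal).map (fun k : ℕ => (k : ℝ≥0∞))
  count_top : ∀ A, MeasurableSet A → ν A = ∞ → ∀ᵐ ω ∂P, N ω A = ∞
  indep : ∀ (m : ℕ) (A : Fin m → Set E), (∀ i, MeasurableSet (A i)) →
    Pairwise (fun i j => Disjoint (A i) (A j)) → iIndepFun (fun i ω => N ω (A i)) P

/-- A countable collection of elements of `E` with finite multiplicities, given by its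
multiplicity function. -/
abbrev Coll (E : Type*) : Type _ := E → ℕ

/-- The point measure `∑_{x ∈ L} δ_x` (with multiplicities). -/
def pointMeasure {E : Type*} [MeasurableSpace E] (L : Coll E) : Measure E :=
  Measure.sum fun x => (L x : ℝ≥0∞) • Measure.dirac x

/-- `𝓛` is a Poisson loop ensemble `𝓛_{α,κ}` on `ℤ^d`, defined on the probability space `(Ω, P)`:
a random collection of loops whose point measure is a Poisson random measure of
intensity `α μ_κ`, where `μ_κ` is the loop measure of the simple random walk. -/
def IsLoopEnsemble {Ω : Type*} [MeasurableSpace Ω] (P : Measure Ω) (d : ℕ) (α κ : ℝ)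
    (𝓛 : Ω → Coll (DiscreteLoop (ZLat d))) : Prop :=
  IsPoissonRandomMeasure P (ENNReal.ofReal α • loopMeasure (srw d) κ) (fun ω => pointMeasure (𝓛 ω))

/-! ### Loop percolation -/

/-- The graph of open edges of a collection of loops: the edges of `G` that are traversed by at
least one loop of the collection. -/
def openGraph {V : Type*} (G : SimpleGraph V) (L : Coll (DiscreteLoop V)) : SimpleGraph V where
  Adj x y := G.Adj x y ∧ ∃ ℓ, L ℓ ≠ 0 ∧ ℓ.Traverses x y
  symm := ⟨fun _ _ ⟨h, ℓ, hℓ, l, hl⟩ => ⟨h.symm, ℓ, hℓ, l, hl.symm⟩⟩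
  loopless := ⟨fun x h => G.loopless.irrefl x h.1⟩

/-- The open cluster of `x`. -/
def openCluster {V : Type*} (G : SimpleGraph V) (L : Coll (DiscreteLoop V)) (x : V) : Set V :=
  {y | (openGraph G L).Reachable x y}

/-- `A ↔ B`: some vertex of `A` and some vertex of `B` lie in the same open cluster. -/
def Connects {V : Type*} (G : SimpleGraph V) (L : Coll (DiscreteLoop V)) (A B : Set V) : Prop :=
  ∃ x ∈ A, ∃ y ∈ B, y ∈ openCluster G L x

/-- Some loop of the collection intersects both `A` and `B`. -/
def ConnectsByOneLoop {V : Type*} (L : Coll (DiscreteLoop V)) (A B : Set V) : Prop :=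
  ∃ ℓ, L ℓ ≠ 0 ∧ (∃ x ∈ A, ℓ.Visits x) ∧ (∃ y ∈ B, ℓ.Visits y)

end

/-! A set of loops of `μ`-mass `m` is charged by the ensemble with probability `1 - exp(-αm)`, so
the second inequality reduces to showing that the loops through `0` and the boundary of the box have
mass at least of order `n^(2-d)`.

Walks from `0` are words of steps, a word of length `k` weighing `(2d)^(-k)`. The `k` rotations of
an excursion of length `k` are distinct based loops, because `0` occurs only once. Hence the factor
`1/k` cancels and the mass is at least the weight of the excursions that go far
(`tsum_excursion_le_loopMeasure`). A closed word that goes far is a far excursion between two closed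
words, so far closed words weigh at most `G²` times as much as far excursions
(`tsum_closed_hits_le`). The Green function `G` at `0` is finite for `d ≥ 3`, by an explicit
superharmonic function (`tsum_closed_lt_top`).

For `k` of order `n²`, the first two moments of `|X_k|²` show that a positive fraction of the words
ends at distance of order `n`, among order `n^d` points. By Cauchy–Schwarz, order `(2d)^(2k) n^(-d)`
pairs share their endpoint (`farPair_lower_bound`). Each pair closes up to a far closed word, and
summing over order `n²` values of `k` gives `n^(2-d)`.

The first inequality holds because almost surely every loop runs along lattice edges, so that its
vertices lie in one cluster. -/

section Walk

/-! ### Words of steps and their loop weights -/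

variable {d : ℕ}

/-- The unit steps of `ℤ^d`. -/
abbrev Step (d : ℕ) : Type := Fin d × Bool

/-- The vector of a step. -/
def Step.vec (s : Step d) : ZLat d := Pi.single s.1 (if s.2 then 1 else -1)

/-- The displacement of a word of steps. -/
def disp (w : List (Step d)) : ZLat d := (w.map Step.vec).sum

/-- The vertices visited by the word `w` started at `x`, without the last one. -/
def path : ZLat d → List (Step d) → List (ZLat d)
  | _, [] => []
  | x, s :: w => x :: path (x + s.vec) w

/-- The vertices visited by the word `w` started at `x`, without the first one. -/
def nexts : ZLat d → List (Step d) → List (ZLat d)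
  | _, [] => []
  | x, s :: w => (x + s.vec) :: nexts (x + s.vec) w

@[simp] lemma disp_nil : disp ([] : List (Step d)) = 0 := rfl

@[simp] lemma disp_cons (s : Step d) (w : List (Step d)) : disp (s :: w) = s.vec + disp w := by
  simp [disp]

@[simp] lemma disp_append (u v : List (Step d)) : disp (u ++ v) = disp u + disp v := by
  simp [disp]

@[simp] lemma length_path (x : ZLat d) (w : List (Step d)) : (path x w).length = w.length := by
  induction w generalizing x with
  | nil => rfl
  | cons s w ih => simp [path, ih]

lemma path_concat (x : ZLat d) (w : List (Step d)) :
    path x w ++ [x + disp w] = x :: nexts x w := by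
  induction w generalizing x with
  | nil => simp [path, nexts]
  | cons s w ih =>
    have := ih (x + s.vec)
    rw [add_assoc] at this
    simp [path, nexts, this]

lemma path_append (x : ZLat d) (u v : List (Step d)) :
    path x (u ++ v) = path x u ++ path (x + disp u) v := by
  induction u generalizing x with
  | nil => simp [path]
  | cons s u ih => simp [path, ih, add_assoc]

lemma mem_path {x y : ZLat d} {w : List (Step d)} :
    y ∈ path x w ↔ ∃ u v, v ≠ [] ∧ w = u ++ v ∧ y = x + disp u := by
  constructor
  · induction w generalizing x with
    | nil => simp [path]
    | cons s w ih =>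
      rintro h
      rcases List.mem_cons.1 h with rfl | h
      · exact ⟨[], s :: w, by simp, by simp, by simp⟩
      · obtain ⟨u, v, hv, rfl, rfl⟩ := ih h
        exact ⟨s :: u, v, hv, by simp, by simp [add_assoc]⟩
  · rintro ⟨u, v, hv, rfl, rfl⟩
    cases v with
    | nil => exact absurd rfl hv
    | cons s v => simp [path_append, path]

lemma Step.vec_injective : Function.Injective (Step.vec (d := d)) := by
  rintro ⟨i, a⟩ ⟨j, b⟩ h
  have hi := congrFun h i
  simp only [Step.vec, Pi.single_eq_same] at hi
  by_cases hij : i = j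
  · subst hij
    cases a <;> cases b <;> simp_all
  · rw [Pi.single_eq_of_ne hij] at hi
    cases a <;> simp at hi

/-- Equal displacements are needed because `path` omits the last vertex and so does not see the last
step. -/
lemma path_injective {x : ZLat d} {w w' : List (Step d)} (h : path x w = path x w')
    (he : disp w = disp w') : w = w' := by
  induction w generalizing x w' with
  | nil =>
    cases w' with
    | nil => rfl
    | cons s w' => simp [path] at h
  | cons s w ih =>
    cases w' with
    | nil => simp [path] at h
    | cons t w' =>
      have hn : x :: nexts x (s :: w) = x :: nexts x (t :: w') := by
        rw [← path_concat, ← path_concat, h, he]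
      simp only [nexts, List.cons.injEq, add_right_inj, true_and] at hn
      obtain rfl := Step.vec_injective hn.1
      simp only [path, List.cons.injEq, true_and] at h
      simp only [disp_cons, add_right_inj] at he
      rw [ih h he]

lemma latGraph_adj_vec (x : ZLat d) (s : Step d) : (latGraph d).Adj x (x + s.vec) := by
  change ∑ i, |x i - (x + s.vec) i| = 1
  rw [Finset.sum_eq_single s.1]
  · simp only [Step.vec, Pi.add_apply, Pi.single_eq_same]
    split_ifs <;> simp
  · intro j _ hj
    simp [Step.vec, Pi.single_eq_of_ne hj]
  · simp

lemma isChain_path (x : ZLat d) (w : List (Step d)) :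
    (path x w ++ [x + disp w]).IsChain (latGraph d).Adj := by
  rw [path_concat]
  induction w generalizing x with
  | nil => simp [nexts]
  | cons s w ih =>
    rw [nexts, List.isChain_cons_cons]
    exact ⟨latGraph_adj_vec x s, ih _⟩

lemma zipWith_srw_path (x : ZLat d) (w : List (Step d)) :
    List.zipWith (srw d) (path x w) (nexts x w) =
      List.replicate w.length (1 / (2 * (d : ℝ))) := by
  induction w generalizing x with
  | nil => rfl
  | cons s w ih =>
    simp [path, nexts, ih, srw, latGraph_adj_vec, List.replicate_succ]

lemma path_rotate_one {w : List (Step d)} {x : ZLat d} (h : disp w = 0) :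
    (path x w).rotate 1 = nexts x w := by
  cases w with
  | nil => rfl
  | cons s w =>
    have h1 := path_concat (x + s.vec) w
    have h2 : x + s.vec + disp w = x := by rw [add_assoc, ← disp_cons, h, add_zero]
    rw [h2] at h1
    simp [path, nexts, h1]

lemma basedLoopWeight_rotate {V : Type*} (Q : V → V → ℝ) (κ : ℝ) (l : List V) (j : ℕ) :
    basedLoopWeight Q κ (l.rotate j) = basedLoopWeight Q κ l := by
  have h : List.zipWith Q (l.rotate j) ((l.rotate j).rotate 1) =
      (List.zipWith Q l (l.rotate 1)).rotate j := by
    rw [List.rotate_rotate, add_comm j 1, ← List.rotate_rotate,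
      List.zipWith_rotate_distrib _ _ _ _ (by simp)]
  rw [basedLoopWeight, basedLoopWeight, h, (List.rotate_perm _ j).prod_eq]
  simp

lemma basedLoopWeight_path {w : List (Step d)} (h : disp w = 0) (j : ℕ) :
    basedLoopWeight (srw d) 0 ((path 0 w).rotate j) =
      1 / (w.length : ℝ) * (1 / (2 * (d : ℝ))) ^ w.length := by
  rw [basedLoopWeight_rotate, basedLoopWeight, path_rotate_one h, zipWith_srw_path]
  simp

/-! ### Cutting an excursion out of a closed walk -/

/-- Words of closed walks that return to their starting point only at the end. -/
def IsExcursion (w : List (Step d)) : Prop :=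
  w ≠ [] ∧ disp w = 0 ∧ ∀ u v, u ≠ [] → v ≠ [] → w = u ++ v → disp u ≠ 0

/-- The walk from `0` with steps `w` visits the set `F`. -/
def Hits (F : Set (ZLat d)) (w : List (Step d)) : Prop :=
  ∃ u v, w = u ++ v ∧ disp u ∈ F

/-- A closed word that is not an excursion splits at an intermediate return to `0`. One of the two
shorter closed halves still hits `F`, and induction on the length applies to it. -/
lemma exists_excursion_decomposition {F : Set (ZLat d)} (h0 : 0 ∉ F) (w : List (Step d))
    (hw : disp w = 0) (hF : Hits F w) :
    ∃ a b c, w = a ++ b ++ c ∧ disp a = 0 ∧ disp c = 0 ∧ IsExcursion b ∧ Hits F b := by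
  induction hn : w.length using Nat.strong_induction_on generalizing w with
  | _ m ih =>
    by_cases he : IsExcursion w
    · exact ⟨[], w, [], by simp, rfl, rfl, he, hF⟩
    have hne : w ≠ [] := by
      rintro rfl
      obtain ⟨u, v, huv, hu⟩ := hF
      obtain ⟨rfl, rfl⟩ := List.nil_eq_append_iff.1 huv
      exact h0 hu
    have : ∃ u v, u ≠ [] ∧ v ≠ [] ∧ w = u ++ v ∧ disp u = 0 := by
      by_contra hcon
      push Not at hcon
      exact he ⟨hne, hw, hcon⟩
    obtain ⟨u, v, hu, hv, rfl, hu0⟩ := this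
    have hv0 : disp v = 0 := by simpa [hu0] using hw
    have hul := List.length_pos_of_ne_nil hu
    have hvl := List.length_pos_of_ne_nil hv
    rw [List.length_append] at hn
    obtain ⟨p, r, hpr, hp⟩ := hF
    rcases List.append_eq_append_iff.1 hpr with ⟨t, rfl, rfl⟩ | ⟨t, rfl, rfl⟩
    · have hF' : Hits F (t ++ r) := ⟨t, r, rfl, by simpa [hu0] using hp⟩
      obtain ⟨a, b, c, he, ha, hc, hb⟩ := ih _ (by omega) (t ++ r) hv0 hF' rfl
      exact ⟨u ++ a, b, c, by simp [he], by simp [hu0, ha], hc, hb⟩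
    · obtain ⟨a, b, c, he, ha, hc, hb⟩ := ih _ (by omega) (p ++ t) hu0 ⟨p, t, rfl, hp⟩ rfl
      exact ⟨a, b, c ++ v, by rw [he]; simp, ha, by simp [hc, hv0], hb⟩

/-- The probability of a word of steps. -/
noncomputable def wordWeight (w : List (Step d)) : ℝ≥0∞ := ENNReal.ofReal (1 / (2 * (d : ℝ))) ^ w.length

lemma wordWeight_append (u v : List (Step d)) :
    wordWeight (u ++ v) = wordWeight u * wordWeight v := by
  simp [wordWeight, pow_add]

/-- Weights are multiplicative, and a chosen decomposition is injective since the three pieces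
concatenate back to the word. -/
lemma tsum_closed_hits_le {F : Set (ZLat d)} (h0 : 0 ∉ F) :
    ∑' w : {w : List (Step d) // disp w = 0 ∧ Hits F w}, wordWeight w.1 ≤
      (∑' w : {w : List (Step d) // disp w = 0}, wordWeight w.1) *
        (∑' w : {w : List (Step d) // IsExcursion w ∧ Hits F w}, wordWeight w.1) *
        ∑' w : {w : List (Step d) // disp w = 0}, wordWeight w.1 := by
  have H (w : {w : List (Step d) // disp w = 0 ∧ Hits F w}) :
      ∃ t : ({w : List (Step d) // disp w = 0} ×
        {w : List (Step d) // IsExcursion w ∧ Hits F w}) × {w : List (Step d) // disp w = 0},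
        w.1 = t.1.1.1 ++ t.1.2.1 ++ t.2.1 := by
    obtain ⟨a, b, c, he, ha, hc, hb⟩ := exists_excursion_decomposition h0 w.1 w.2.1 w.2.2
    exact ⟨⟨⟨⟨a, ha⟩, ⟨b, hb⟩⟩, ⟨c, hc⟩⟩, he⟩
  choose φ hφ using H
  have hinj : Function.Injective φ := fun w w' h => Subtype.ext (by rw [hφ w, hφ w', h])
  let g : ({w : List (Step d) // disp w = 0} ×
      {w : List (Step d) // IsExcursion w ∧ Hits F w}) × {w : List (Step d) // disp w = 0} →
      ℝ≥0∞ := fun t => wordWeight t.1.1.1 * wordWeight t.1.2.1 * wordWeight t.2.1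
  have hg (w) : wordWeight w.1 = g (φ w) := by
    rw [hφ w, wordWeight_append, wordWeight_append]
  simp_rw [hg]
  refine (ENNReal.tsum_comp_le_tsum_of_injective hinj g).trans_eq ?_
  simp_rw [g, ENNReal.tsum_prod', ENNReal.tsum_mul_left, ENNReal.tsum_mul_right,
    ENNReal.tsum_mul_left]
  rw [ENNReal.tsum_mul_right]

/-! ### From excursions to the loop measure -/

lemma IsExcursion.two_le_length {w : List (Step d)} (hw : IsExcursion w) : 2 ≤ w.length := by
  obtain ⟨h, h0, -⟩ := hw
  match w with
  | [] => exact absurd rfl h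
  | [s] =>
    have := (latGraph_adj_vec 0 s).ne
    simp_all
  | _ :: _ :: _ => simp

lemma chain_path {w : List (Step d)} (h : disp w = 0) :
    Cycle.Chain (fun x y => x ≠ y) (path 0 w : Cycle (ZLat d)) := by
  cases w with
  | nil => exact Cycle.Chain.nil _
  | cons s w =>
    have := isChain_path 0 (s :: w)
    rw [h] at this
    simp only [path, List.cons_append, add_zero] at this ⊢
    rw [Cycle.chain_coe_cons]
    exact this.imp fun _ _ h => h.ne

lemma coe_rotate {α : Type*} (l : List α) (j : ℕ) : ((l.rotate j : List α) : Cycle α) = l :=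
  Cycle.coe_eq_coe.2 (List.IsRotated.symm ⟨j, rfl⟩)

/-- The based loop obtained from an excursion by shifting its starting point. -/
def IsExcursion.basedLoop {w : List (Step d)} (hw : IsExcursion w) (j : ℕ) :
    BasedLoop (ZLat d) :=
  ⟨(path 0 w).rotate j, by simpa using hw.two_le_length, by
    rw [coe_rotate]; exact chain_path hw.2.1⟩

lemma IsExcursion.getElem_path_eq_zero {w : List (Step d)} (hw : IsExcursion w) {i : ℕ}
    (hi : i < (path 0 w).length) : (path 0 w)[i] = 0 ↔ i = 0 := by
  have hi' : i < w.length := by simpa using hi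
  have key : (path 0 w)[i] = disp (w.take i) := by
    have h2 : path 0 w = path 0 (w.take i) ++ path (0 + disp (w.take i)) (w.drop i) := by
      rw [← path_append, List.take_append_drop]
    have hd : w.drop i ≠ [] := by simpa using hi'
    obtain ⟨s, v, hv⟩ := List.exists_cons_of_ne_nil hd
    rw [List.getElem_of_eq h2, List.getElem_append_right (by simp)]
    simp [hv, path, min_eq_left hi'.le]
  rw [key]
  constructor
  · intro h
    by_contra h0
    refine hw.2.2 (w.take i) (w.drop i) ?_ ?_ (by simp) h
    · simpa using ⟨h0, hw.1⟩
    · simpa using hi'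
  · rintro rfl
    simp

/-- The unique position of `0` in the rotated list reveals the shift; undoing it recovers the path.
-/
lemma rotate_path_injective {w w' : List (Step d)} (hw : IsExcursion w) (hw' : IsExcursion w')
    {j j' : ℕ} (hj : j < w.length) (hj' : j' < w'.length)
    (h : (path 0 w).rotate j = (path 0 w').rotate j') : w = w' ∧ j = j' := by
  have hl : w.length = w'.length := by simpa using congrArg List.length h
  have hm : (w.length - j) % w.length < w.length := Nat.mod_lt _ (by omega)
  have e1 := List.getElem_rotate (path 0 w) j ((w.length - j) % w.length) (by simpa using hm)
  have e2 := List.getElem_rotate (path 0 w') j' ((w.length - j) % w.length)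
    (by simpa [← hl] using hm)
  have h1 : ((w.length - j) % w.length + j) % (path 0 w).length = 0 := by
    rw [length_path, Nat.mod_add_mod, Nat.sub_add_cancel hj.le, Nat.mod_self]
  have h2 : ((w.length - j) % w.length + j') % (path 0 w').length = 0 := by
    rw [← hw'.getElem_path_eq_zero (Nat.mod_lt _ (by simp; omega)), ← e2,
      ← List.getElem_of_eq h (by simpa using hm), e1, hw.getElem_path_eq_zero]
    exact h1
  have hjj : j = j' := by
    rw [length_path, ← hl, Nat.mod_add_mod] at h2
    have := Nat.dvd_of_mod_eq_zero h2
    obtain ⟨c, hc⟩ := this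
    -- The multiple `(w.length - j) + j'` of `w.length` lies strictly between `0` and `2 *
    -- w.length`.
    have hc1 : c = 1 := by
      rcases Nat.lt_or_ge c 1 with h0 | h0
      · obtain rfl : c = 0 := by omega
        omega
      · rcases Nat.lt_or_ge 1 c with h3 | h3
        · have : w.length * 2 ≤ w.length * c := Nat.mul_le_mul_left _ h3
          omega
        · omega
    subst hc1
    omega
  subst hjj
  exact ⟨path_injective (List.rotate_injective j h) (hw.2.1.trans hw'.2.1.symm), rfl⟩

lemma loopMeasure_apply {V : Type*} (Q : V → V → ℝ) (κ : ℝ) (S : Set (DiscreteLoop V)) :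
    loopMeasure Q κ S = ∑' b : BasedLoop V,
      ENNReal.ofReal (basedLoopWeight Q κ b.1) * S.indicator 1 b.toLoop := by
  have hS : MeasurableSet S := MeasurableSpace.measurableSet_top
  have hm : Measurable (BasedLoop.toLoop (V := V)) := measurable_from_top
  rw [loopMeasure, Measure.map_apply hm hS, basedLoopMeasure, Measure.sum_apply _ (hm hS)]
  refine tsum_congr fun b => ?_
  rw [Measure.smul_apply, Measure.dirac_apply' _ (hm hS), smul_eq_mul]
  rfl

/-- The loops visiting `0` and the boundary of the box of radius `n`. -/
def crossingLoops (d n : ℕ) : Set (DiscreteLoop (ZLat d)) :=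
  {ℓ | ℓ.Visits 0 ∧ ∃ y ∈ vertexBoundary (latGraph d) (box 0 n), ℓ.Visits y}

/-- The vertices at distance at least `n` from the origin. -/
def farSet (d n : ℕ) : Set (ZLat d) := {x | ∃ i, (n : ℤ) ≤ |x i|}

lemma exists_lt_abs_add_vec (i : Fin d) (z : ℤ) (n : ℕ) (h : |z| = n) :
    ∃ s : Step d, (n : ℤ) < |z + s.vec i| := by
  rcases abs_cases z with ⟨h1, h2⟩ | ⟨h1, h2⟩
  · refine ⟨(i, true), ?_⟩
    simp only [Step.vec, Pi.single_eq_same, if_true]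
    rw [lt_abs]; left; omega
  · refine ⟨(i, false), ?_⟩
    simp only [Step.vec, Pi.single_eq_same]
    rw [lt_abs]; right; simp; omega

lemma abs_vec_le (s : Step d) (i : Fin d) : |s.vec i| ≤ 1 := by
  unfold Step.vec
  by_cases h : i = s.1
  · subst h
    rw [Pi.single_eq_same]
    split_ifs <;> simp
  · simp [Pi.single_eq_of_ne h]

/-- Coordinates change by at most `1` per step, so on first reaching `farSet` the walk is still in
the box, with some coordinate equal to `±n`; one more step in that direction would leave it. -/
lemma exists_prefix_mem_boundary {n : ℕ} (hn : 1 ≤ n) (u : List (Step d))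
    (h : disp u ∈ farSet d n) :
    ∃ a b, u = a ++ b ∧ disp a ∈ vertexBoundary (latGraph d) (box 0 n) := by
  induction u using List.reverseRecOn with
  | nil =>
    obtain ⟨i, hi⟩ := h
    simp at hi
    omega
  | append_singleton v s ih =>
    by_cases hv : disp v ∈ farSet d n
    · obtain ⟨a, b, rfl, ha⟩ := ih hv
      exact ⟨a, b ++ [s], by simp, ha⟩
    · simp only [farSet, Set.mem_ofPred_eq, not_exists, not_le] at hv
      obtain ⟨i, hi⟩ := h
      have hle : ∀ j, |disp (v ++ [s]) j| ≤ n := fun j => by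
        have h1 := hv j
        have h2 := abs_vec_le s j
        have h3 := abs_add_le (disp v j) (s.vec j)
        simp only [disp_append, disp_cons, disp_nil, add_zero, Pi.add_apply]
        omega
      obtain ⟨t, ht⟩ := exists_lt_abs_add_vec i _ n (le_antisymm (hle i) hi)
      refine ⟨v ++ [s], [], by simp, fun j => by simpa using hle j, disp (v ++ [s]) + t.vec, ?_,
        latGraph_adj_vec _ t⟩
      intro hmem
      have := hmem i
      simp only [Pi.zero_apply, sub_zero, Pi.add_apply] at this ht
      omega

lemma zero_notMem_boundary {n : ℕ} (hn : 1 ≤ n) :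
    (0 : ZLat d) ∉ vertexBoundary (latGraph d) (box 0 n) := by
  rintro ⟨-, y, hy, hadj⟩
  refine hy fun i => ?_
  have h1 : ∑ i, |(0 : ZLat d) i - y i| = 1 := hadj
  have := Finset.single_le_sum (f := fun i => |(0 : ZLat d) i - y i|)
    (fun _ _ => abs_nonneg _) (Finset.mem_univ i)
  simp only [Pi.zero_apply, zero_sub, abs_neg, sub_zero] at this h1 ⊢
  omega

lemma IsExcursion.basedLoop_mem {n : ℕ} (hn : 1 ≤ n) {w : List (Step d)} (hw : IsExcursion w)
    (hF : Hits (farSet d n) w) (j : ℕ) : (hw.basedLoop j).toLoop ∈ crossingLoops d n := by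
  have hv (x : ZLat d) : (hw.basedLoop j).toLoop.Visits x ↔ x ∈ path 0 w := by
    change x ∈ (((path 0 w).rotate j : List (ZLat d)) : Cycle (ZLat d)) ↔ _
    simp
  obtain ⟨u, v, huv, hu⟩ := hF
  obtain ⟨a, b, rfl, ha⟩ := exists_prefix_mem_boundary hn u hu
  refine ⟨(hv 0).2 (mem_path.2 ⟨[], w, hw.1, by simp, by simp⟩), disp a, ha,
    (hv _).2 (mem_path.2 ⟨a, b ++ v, ?_, by simpa using huv, by simp⟩)⟩
  -- `path` omits the last vertex, so a non-empty rest is required. Were it empty, `a` would be the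
  -- whole closed word and `0` would lie on the boundary.
  intro h
  rw [List.append_assoc, h, List.append_nil] at huv
  subst huv
  exact zero_notMem_boundary hn (hw.2.1 ▸ ha)

lemma tsum_excursion_le_loopMeasure {n : ℕ} (hn : 1 ≤ n) :
    ∑' w : {w : List (Step d) // IsExcursion w ∧ Hits (farSet d n) w}, wordWeight w.1 ≤
      loopMeasure (srw d) 0 (crossingLoops d n) := by
  rw [loopMeasure_apply]
  let ψ : (Σ w : {w : List (Step d) // IsExcursion w ∧ Hits (farSet d n) w}, Fin w.1.length) →
      BasedLoop (ZLat d) := fun t => t.1.2.1.basedLoop t.2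
  have hψ : Function.Injective ψ := by
    rintro ⟨⟨w, hw⟩, j⟩ ⟨⟨w', hw'⟩, j'⟩ h
    obtain ⟨rfl, hj⟩ := rotate_path_injective hw.1 hw'.1 j.2 j'.2 (congrArg Subtype.val h)
    obtain rfl := Fin.ext hj
    rfl
  refine le_trans (le_of_eq ?_) (ENNReal.tsum_comp_le_tsum_of_injective hψ _)
  rw [ENNReal.tsum_sigma']
  refine tsum_congr fun w => ?_
  have hlen : 0 < w.1.length := by have := w.2.1.two_le_length; omega
  have (j : Fin w.1.length) : ENNReal.ofReal (basedLoopWeight (srw d) 0 (ψ ⟨w, j⟩).1) *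
      (crossingLoops d n).indicator 1 (ψ ⟨w, j⟩).toLoop =
        (w.1.length : ℝ≥0∞)⁻¹ * wordWeight w.1 := by
    rw [Set.indicator_of_mem (w.2.1.basedLoop_mem hn w.2.2 j), Pi.one_apply, mul_one]
    change ENNReal.ofReal (basedLoopWeight (srw d) 0 ((path 0 w.1).rotate j)) = _
    rw [basedLoopWeight_path w.2.1.2.1, ENNReal.ofReal_mul (by positivity), one_div,
      ENNReal.ofReal_inv_of_pos (by exact_mod_cast hlen), ENNReal.ofReal_natCast,
      ENNReal.ofReal_pow (by positivity), wordWeight]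
  simp_rw [this]
  rw [tsum_fintype, Finset.sum_const, Finset.card_univ, Fintype.card_fin, nsmul_eq_mul,
    ← mul_assoc, ENNReal.mul_inv_cancel (by exact_mod_cast hlen.ne') (by simp), one_mul]

/-! ### The transition operator and moments of the walk -/

/-- The transition operator of the simple random walk. -/
noncomputable def avg (f : ZLat d → ℝ) (x : ZLat d) : ℝ :=
  1 / (2 * (d : ℝ)) * ∑ s : Step d, f (x + s.vec)

lemma avg_mono {f g : ZLat d → ℝ} (h : ∀ x, f x ≤ g x) (x : ZLat d) : avg f x ≤ avg g x :=
  mul_le_mul_of_nonneg_left (Finset.sum_le_sum fun s _ => h _) (by positivity)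

lemma avg_add (f g : ZLat d → ℝ) (x : ZLat d) :
    avg (fun y => f y + g y) x = avg f x + avg g x := by
  simp [avg, Finset.sum_add_distrib, mul_add]

lemma avg_const_mul (c : ℝ) (f : ZLat d → ℝ) (x : ZLat d) :
    avg (fun y => c * f y) x = c * avg f x := by
  simp only [avg, ← Finset.mul_sum]
  ring

lemma avg_const (hd : d ≠ 0) (c : ℝ) (x : ZLat d) : avg (fun _ => c) x = c := by
  have : (d : ℝ) ≠ 0 := by exact_mod_cast hd
  simp [avg, Fintype.card_prod]
  field_simp

lemma avg_sum {ι : Type*} (t : Finset ι) (f : ι → ZLat d → ℝ) (x : ZLat d) :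
    avg (fun y => ∑ i ∈ t, f i y) x = ∑ i ∈ t, avg (f i) x := by
  simp only [avg]
  rw [Finset.sum_comm, Finset.mul_sum]

lemma avg_eq_sum (f : ZLat d → ℝ) (x : ZLat d) :
    avg f x = 1 / (2 * (d : ℝ)) *
      ∑ i, (f (x + Step.vec (i, true)) + f (x + Step.vec (i, false))) := by
  simp [avg, Fintype.sum_prod_type]

/-- The squared Euclidean norm. -/
def normSq (x : ZLat d) : ℝ := ∑ i, (x i : ℝ) ^ 2

lemma normSq_nonneg (x : ZLat d) : 0 ≤ normSq x := Finset.sum_nonneg fun _ _ => sq_nonneg _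

lemma sq_le_normSq (x : ZLat d) (i : Fin d) : (x i : ℝ) ^ 2 ≤ normSq x :=
  Finset.single_le_sum (f := fun i => (x i : ℝ) ^ 2) (fun _ _ => sq_nonneg _) (Finset.mem_univ i)

@[simp] lemma normSq_zero : normSq (0 : ZLat d) = 0 := by simp [normSq]

lemma normSq_add_vec (x : ZLat d) (s : Step d) :
    normSq (x + s.vec) = normSq x + 1 + 2 * (if s.2 then 1 else -1) * x s.1 := by
  have h : ∀ j, (((x + s.vec) j : ℤ) : ℝ) ^ 2 =
      (x j : ℝ) ^ 2 + if j = s.1 then 1 + 2 * (if s.2 then 1 else -1) * (x s.1 : ℝ) else 0 := by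
    intro j
    by_cases hj : j = s.1
    · subst hj
      simp only [Step.vec, Pi.add_apply, Pi.single_eq_same, if_true]
      split_ifs <;> push_cast <;> ring
    · simp [Step.vec, hj]
  simp only [normSq, h, Finset.sum_add_distrib, Finset.sum_ite_eq', Finset.mem_univ, if_true]
  ring

lemma avg_normSq (hd : d ≠ 0) (x : ZLat d) : avg normSq x = normSq x + 1 := by
  have hd' : (d : ℝ) ≠ 0 := by exact_mod_cast hd
  have h (i : Fin d) : normSq (x + Step.vec (i, true)) + normSq (x + Step.vec (i, false)) =
      2 * (normSq x + 1) := by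
    rw [normSq_add_vec, normSq_add_vec]; simp; ring
  rw [avg_eq_sum]
  simp only [h, Finset.sum_const, Finset.card_univ, Fintype.card_fin, nsmul_eq_mul]
  field_simp

lemma avg_normSq_sq (hd : d ≠ 0) (x : ZLat d) :
    avg (fun y => normSq y ^ 2) x = normSq x ^ 2 + (2 + 4 / d) * normSq x + 1 := by
  have hd' : (d : ℝ) ≠ 0 := by exact_mod_cast hd
  have h (i : Fin d) :
      normSq (x + Step.vec (i, true)) ^ 2 + normSq (x + Step.vec (i, false)) ^ 2 =
        2 * (normSq x + 1) ^ 2 + 8 * (x i : ℝ) ^ 2 := by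
    rw [normSq_add_vec, normSq_add_vec]; simp; ring
  rw [avg_eq_sum]
  simp only [h, Finset.sum_add_distrib, ← Finset.mul_sum, Finset.sum_const, Finset.card_univ,
    Fintype.card_fin, nsmul_eq_mul]
  change 1 / (2 * (d : ℝ)) * (2 * (d * (normSq x + 1) ^ 2) + 8 * normSq x) = _
  field_simp
  ring

lemma avg_iterate_normSq (hd : d ≠ 0) (k : ℕ) (x : ZLat d) :
    avg^[k] normSq x = normSq x + k := by
  induction k generalizing x with
  | zero => simp
  | succ k ih =>
    rw [Function.iterate_succ_apply', funext ih, avg_add, avg_normSq hd, avg_const hd]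
    push_cast; ring

lemma avg_iterate_normSq_sq (hd : d ≠ 0) (k : ℕ) (x : ZLat d) :
    avg^[k] (fun y => normSq y ^ 2) x =
      normSq x ^ 2 + (2 + 4 / d) * k * normSq x + ((1 + 2 / d) * (k * (k - 1)) + k) := by
  induction k generalizing x with
  | zero => simp
  | succ k ih =>
    rw [Function.iterate_succ_apply', funext ih, avg_add, avg_add, avg_const_mul,
      avg_normSq hd, avg_normSq_sq hd, avg_const hd]
    push_cast; ring

lemma avg_iterate_add (k : ℕ) (f g : ZLat d → ℝ) (x : ZLat d) :
    avg^[k] (fun y => f y + g y) x = avg^[k] f x + avg^[k] g x := by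
  induction k generalizing x with
  | zero => simp
  | succ k ih => simp only [Function.iterate_succ_apply', funext ih, avg_add]

lemma avg_iterate_const_mul (k : ℕ) (c : ℝ) (f : ZLat d → ℝ) (x : ZLat d) :
    avg^[k] (fun y => c * f y) x = c * avg^[k] f x := by
  induction k generalizing x with
  | zero => simp
  | succ k ih => simp only [Function.iterate_succ_apply', funext ih, avg_const_mul]

lemma avg_iterate_const (hd : d ≠ 0) (k : ℕ) (c : ℝ) (x : ZLat d) :
    avg^[k] (fun _ => c) x = c := by
  induction k generalizing x with
  | zero => simp
  | succ k ih => simp only [Function.iterate_succ_apply', funext ih, avg_const hd]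

lemma avg_iterate_mono (k : ℕ) {f g : ZLat d → ℝ} (h : ∀ x, f x ≤ g x) (x : ZLat d) :
    avg^[k] f x ≤ avg^[k] g x := by
  induction k generalizing x with
  | zero => simpa using h x
  | succ k ih => simpa only [Function.iterate_succ_apply'] using avg_mono ih x

/-- The law of the simple random walk does not vanish on the diffusive scale. -/
lemma one_le_avg_iterate_indicator (hd : 2 ≤ d) {k : ℕ} (hk : 1 ≤ k) :
    1 ≤ 11 * avg^[k] ({x : ZLat d | (k : ℝ) / 2 ≤ normSq x ∧ normSq x ≤ 7 * k}.indicator 1) 0 := by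
  have hd0 : d ≠ 0 := by omega
  have hk' : (1 : ℝ) ≤ k := by exact_mod_cast hk
  have hd' : (2 : ℝ) ≤ d := by exact_mod_cast hd
  set R := {x : ZLat d | (k : ℝ) / 2 ≤ normSq x ∧ normSq x ≤ 7 * k}
  -- With `s = normSq x`, the left side is `-(s - k/2)(s - 7k)`: negative off `R`, and at most
  -- `(13k/4)² ≤ 11k²` on it. Its mean after `k` steps is at least `k²`, because `normSq` has mean
  -- `k` and second moment at most `2k²`.
  have hp (x : ZLat d) : (-1) * normSq x ^ 2 + (15 / 2 * k * normSq x + -(7 / 2) * k ^ 2) ≤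
      11 * (k : ℝ) ^ 2 * R.indicator 1 x := by
    by_cases hx : x ∈ R
    · rw [Set.indicator_of_mem hx, Pi.one_apply]
      nlinarith [sq_nonneg (normSq x - 15 / 4 * k)]
    · rw [Set.indicator_of_notMem hx]
      have : normSq x < k / 2 ∨ 7 * k < normSq x := by
        by_contra hcon
        push Not at hcon
        exact hx hcon
      rcases this with h | h
      · nlinarith
      · nlinarith
  have h1 := avg_iterate_mono k hp 0
  rw [avg_iterate_add, avg_iterate_add, avg_iterate_const_mul, avg_iterate_const_mul,
    avg_iterate_const_mul, avg_iterate_const_mul, avg_iterate_normSq hd0, avg_iterate_normSq_sq hd0,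
    avg_iterate_const hd0, normSq_zero] at h1
  have h2 : (1 + 2 / (d : ℝ)) * (k * (k - 1)) ≤ 2 * (k * (k - 1)) := by
    refine mul_le_mul_of_nonneg_right ?_ (by nlinarith)
    have : 2 / (d : ℝ) ≤ 1 := by rw [div_le_one (by positivity)]; exact hd'
    linarith
  have h3 : (k : ℝ) ^ 2 * 1 ≤ k ^ 2 * (11 * avg^[k] (R.indicator 1) 0) := by nlinarith
  exact le_of_mul_le_mul_left h3 (by positivity)

lemma sum_words (hd : d ≠ 0) (k : ℕ) (f : ZLat d → ℝ) (x : ZLat d) :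
    ∑ u : Fin k → Step d, f (x + disp (List.ofFn u)) = (2 * (d : ℝ)) ^ k * avg^[k] f x := by
  have hd' : (d : ℝ) ≠ 0 := by exact_mod_cast hd
  induction k generalizing x with
  | zero => simp
  | succ k ih =>
    rw [← (Fin.consEquiv fun _ => Step d).sum_comp, Fintype.sum_prod_type]
    have (s : Step d) (u : Fin k → Step d) :
        f (x + disp (List.ofFn (Fin.consEquiv (fun _ => Step d) (s, u)))) =
          f (x + s.vec + disp (List.ofFn u)) := by
      simp [Fin.consEquiv, add_assoc]
    simp_rw [this, ih]
    rw [Function.iterate_succ_apply', avg, ← Finset.mul_sum]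
    field_simp
    ring

/-! ### Finiteness of the Green function -/

/-- A positive superharmonic function bounds the Green function. -/
lemma sum_avg_iterate_le {h δ : ZLat d → ℝ} (h0 : ∀ x, 0 ≤ h x)
    (hs : ∀ x, avg h x + δ x ≤ h x) (k : ℕ) (x : ZLat d) :
    ∑ j ∈ Finset.range k, avg^[j] δ x ≤ h x := by
  -- Keeping the remainder `avg^[k] h` makes the induction close; it is non-negative and is dropped
  -- at the end.
  have (k : ℕ) : ∀ x, ∑ j ∈ Finset.range k, avg^[j] δ x + avg^[k] h x ≤ h x := by
    induction k with
    | zero => simp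
    | succ k ih =>
      intro x
      have h1 := avg_mono ih x
      rw [avg_add, avg_sum] at h1
      rw [Finset.sum_range_succ']
      simp only [Function.iterate_succ_apply', Function.iterate_zero, id]
      linarith [hs x]
  have hk := this k x
  have : 0 ≤ avg^[k] h x := by
    clear hk this
    induction k generalizing x with
    | zero => simpa using h0 x
    | succ k ih =>
      rw [Function.iterate_succ_apply']
      exact mul_nonneg (by positivity) (Finset.sum_nonneg fun s _ => ih _)
  linarith

/-- The Taylor coefficient of `t²` is `5/32`; the excess of `3/16` absorbs the higher terms. -/
lemma one_add_rpow_neg_quarter_le {t : ℝ} (ht : |t| ≤ 1 / 10) :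
    (1 + t) ^ (-(1 / 4) : ℝ) ≤ 1 - t / 4 + 3 / 16 * t ^ 2 := by
  obtain ⟨h1, h2⟩ := abs_le.1 ht
  have hpos : 0 < 1 + t := by linarith
  have hb : 0 ≤ 1 - t / 4 + 3 / 16 * t ^ 2 := by nlinarith
  have hpow : ((1 + t) ^ (-(1 / 4) : ℝ)) ^ 4 = (1 + t)⁻¹ := by
    rw [← Real.rpow_natCast, ← Real.rpow_mul hpos.le, ← Real.rpow_neg_one]
    norm_num
  refine le_of_pow_le_pow_left₀ (n := 4) (by norm_num) hb ?_
  rw [hpow, inv_le_iff_one_le_mul₀ hpos]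
  -- The fourth power is taken as two squarings. The intermediate coefficient `17/40` lies between
  -- `3/8`, from the expansion of `(1 + t)^(-1/2)`, and `7/16`, from squaring the right side.
  have hc : 0 ≤ 1 - t / 2 + 17 / 40 * t ^ 2 := by nlinarith
  have hbc : 1 - t / 2 + 17 / 40 * t ^ 2 ≤ (1 - t / 4 + 3 / 16 * t ^ 2) ^ 2 := by
    have : (1 - t / 4 + 3 / 16 * t ^ 2) ^ 2 - (1 - t / 2 + 17 / 40 * t ^ 2) =
        t ^ 2 * (1 / 80 - 3 / 32 * t + 9 / 256 * t ^ 2) := by ring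
    have h3 : 0 ≤ 1 / 80 - 3 / 32 * t + 9 / 256 * t ^ 2 := by nlinarith
    nlinarith [mul_nonneg (sq_nonneg t) h3]
  have hc2 : 1 ≤ (1 - t / 2 + 17 / 40 * t ^ 2) ^ 2 * (1 + t) := by
    have : (1 - t / 2 + 17 / 40 * t ^ 2) ^ 2 * (1 + t) - 1 =
        t ^ 2 * (1 / 10 + 27 / 40 * t - 391 / 1600 * t ^ 2 + 289 / 1600 * t ^ 3) := by ring
    have h3 : 0 ≤ 1 / 10 + 27 / 40 * t - 391 / 1600 * t ^ 2 + 289 / 1600 * t ^ 3 := by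
      have h4 : t ^ 2 ≤ 1 / 100 := by nlinarith
      have h5 : -(1 / 1000) ≤ t ^ 3 := by nlinarith [sq_nonneg t]
      linarith
    nlinarith [mul_nonneg (sq_nonneg t) h3]
  calc (1 : ℝ) ≤ (1 - t / 2 + 17 / 40 * t ^ 2) ^ 2 * (1 + t) := hc2
    _ ≤ ((1 - t / 4 + 3 / 16 * t ^ 2) ^ 2) ^ 2 * (1 + t) := by gcongr
    _ = _ := by ring

lemma one_add_le_one_sub_rpow_neg_quarter {s : ℝ} (h0 : 0 ≤ s) (h1 : s < 1) :
    1 + s / 4 ≤ (1 - s) ^ (-(1 / 4) : ℝ) := by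
  have h := rpow_one_add_le_one_add_mul_self (s := -s) (by linarith) (p := 1 / 4)
    (by norm_num) (by norm_num)
  rw [← sub_eq_add_neg] at h
  have hp : 0 < (1 - s) ^ (1 / 4 : ℝ) := Real.rpow_pos_of_pos (by linarith) _
  rw [Real.rpow_neg (by linarith), le_inv_comm₀ (by positivity) hp]
  refine h.trans ?_
  rw [← one_div, le_div_iff₀ (by positivity)]
  nlinarith

/-- A positive strictly superharmonic function on `ℤ^d`, `d ≥ 3`. -/
noncomputable def superharmonic (x : ZLat d) : ℝ := (normSq x + 100) ^ (-(1 / 4) : ℝ)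

lemma superharmonic_pos (x : ZLat d) : 0 < superharmonic x :=
  Real.rpow_pos_of_pos (by linarith [normSq_nonneg x]) _

/-- The two neighbours have `normSq + 100 = U(1 ± t)`, so the terms linear in `t` cancel. The shift
by `100` ensures `|t| ≤ 1/10`, as `20|x i| ≤ (x i)² + 101`. -/
lemma superharmonic_add_vec_le (x : ZLat d) (i : Fin d) :
    superharmonic (x + Step.vec (i, true)) + superharmonic (x + Step.vec (i, false)) ≤
      (normSq x + 101) ^ (-(1 / 4) : ℝ) *
        (2 + 3 / 2 * (x i : ℝ) ^ 2 / (normSq x + 101) ^ 2) := by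
  have hN := normSq_nonneg x
  have hx := sq_le_normSq x i
  set U := normSq x + 101 with hU
  have hU0 : 0 < U := by linarith
  set t := 2 * (x i : ℝ) / U with ht
  have habs : |t| ≤ 1 / 10 := by
    rw [ht, abs_div, abs_of_pos hU0, div_le_iff₀ hU0, abs_mul, abs_of_pos (two_pos)]
    nlinarith [sq_nonneg (|(x i : ℝ)| - 10), sq_abs (x i : ℝ)]
  have hUt : U * t = 2 * x i := by rw [ht]; field_simp
  have e1 : superharmonic (x + Step.vec (i, true)) =
      U ^ (-(1 / 4) : ℝ) * (1 + t) ^ (-(1 / 4) : ℝ) := by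
    rw [superharmonic, normSq_add_vec, ← Real.mul_rpow hU0.le (by linarith [(abs_le.1 habs).1])]
    congr 1
    rw [mul_add, hUt, hU]; simp; ring
  have e2 : superharmonic (x + Step.vec (i, false)) =
      U ^ (-(1 / 4) : ℝ) * (1 + -t) ^ (-(1 / 4) : ℝ) := by
    rw [superharmonic, normSq_add_vec, ← Real.mul_rpow hU0.le (by linarith [(abs_le.1 habs).2])]
    congr 1
    rw [mul_add, mul_neg, hUt, hU]; simp; ring
  rw [e1, e2, ← mul_add]
  refine mul_le_mul_of_nonneg_left ?_ (Real.rpow_nonneg hU0.le _)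
  have h1 := one_add_rpow_neg_quarter_le habs
  have h2 := one_add_rpow_neg_quarter_le (t := -t) (by rwa [abs_neg])
  have h3 : 3 / 2 * (x i : ℝ) ^ 2 / U ^ 2 = 3 / 8 * t ^ 2 := by rw [ht]; field_simp; ring
  rw [h3]
  linarith

/-- With `N = normSq x`, `U = N + 101` and `W = U^(-1/4)`, the average is at most `W(1 + (3/d)
N/(4U²))`, while the value at `x` is at least `W(1 + 1/(4U))`. For `d ≥ 3` the gap is at least `101
W/(4U²)`. -/
lemma avg_superharmonic_le (hd : 3 ≤ d) (x : ZLat d) :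
    avg superharmonic x + 101 / 4 * (normSq x + 101) ^ (-(1 / 4) : ℝ) / (normSq x + 101) ^ 2 ≤
      superharmonic x := by
  have hN := normSq_nonneg x
  have hd' : (3 : ℝ) ≤ d := by exact_mod_cast hd
  have h1 : avg superharmonic x ≤ 1 / (2 * (d : ℝ)) * ∑ i, (normSq x + 101) ^ (-(1 / 4) : ℝ) *
        (2 + 3 / 2 * (x i : ℝ) ^ 2 / (normSq x + 101) ^ 2) := by
    rw [avg_eq_sum]
    exact mul_le_mul_of_nonneg_left
      (Finset.sum_le_sum fun i _ => superharmonic_add_vec_le x i) (by positivity)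
  rw [← Finset.mul_sum, Finset.sum_add_distrib, ← Finset.sum_div, ← Finset.mul_sum,
    Finset.sum_const, Finset.card_univ, Fintype.card_fin, nsmul_eq_mul] at h1
  change _ ≤ 1 / (2 * (d : ℝ)) * (_ * (_ + 3 / 2 * normSq x / _)) at h1
  have h3 : (normSq x + 101) ^ (-(1 / 4) : ℝ) * (1 + 1 / (normSq x + 101) / 4) ≤
      superharmonic x := by
    have h4 := one_add_le_one_sub_rpow_neg_quarter (s := 1 / (normSq x + 101)) (by positivity)
      (by rw [div_lt_one (by linarith)]; linarith)
    have h5 : superharmonic x = (normSq x + 101) ^ (-(1 / 4) : ℝ) *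
        (1 - 1 / (normSq x + 101)) ^ (-(1 / 4) : ℝ) := by
      rw [superharmonic, ← Real.mul_rpow (by linarith)
        (by rw [sub_nonneg, div_le_one (by linarith)]; linarith)]
      congr 1
      field_simp
      ring
    rw [h5]
    gcongr
  refine le_trans ?_ h3
  have hW : 0 < (normSq x + 101) ^ (-(1 / 4) : ℝ) := Real.rpow_pos_of_pos (by linarith) _
  set W := (normSq x + 101) ^ (-(1 / 4) : ℝ)
  set N := normSq x
  have h6 : 1 / (2 * (d : ℝ)) * (W * (d * 2 + 3 / 2 * N / (N + 101) ^ 2)) ≤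
      W * (1 + N / (4 * (N + 101) ^ 2)) := by
    have : 1 / (2 * (d : ℝ)) * (W * (d * 2 + 3 / 2 * N / (N + 101) ^ 2)) =
        W * (1 + 3 / d * (N / (4 * (N + 101) ^ 2))) := by field_simp; ring
    rw [this]
    gcongr
    refine mul_le_of_le_one_left (by positivity) ?_
    rw [div_le_one (by linarith)]
    exact hd'
  have h7 : W * (1 + N / (4 * (N + 101) ^ 2)) + 101 / 4 * W / (N + 101) ^ 2 =
      W * (1 + 1 / (N + 101) / 4) := by field_simp; ring
  linarith

lemma exists_green_bound (hd : 3 ≤ d) : ∃ C : ℝ, ∀ k : ℕ,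
    ∑ j ∈ Finset.range k, avg^[j] (({0} : Set (ZLat d)).indicator 1) 0 ≤ C := by
  set ε : ℝ := 101 / 4 * 101 ^ (-(1 / 4) : ℝ) / 101 ^ 2 with hε
  have hε0 : 0 < ε := by positivity
  refine ⟨superharmonic (0 : ZLat d) / ε, fun k => ?_⟩
  have := sum_avg_iterate_le (h := superharmonic)
    (δ := fun x => ε * ({0} : Set (ZLat d)).indicator 1 x) (fun x => (superharmonic_pos x).le)
    (fun x => ?_) k 0
  · simp_rw [avg_iterate_const_mul] at this
    rw [← Finset.mul_sum] at this
    rwa [le_div_iff₀ hε0, mul_comm]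
  · have h1 := avg_superharmonic_le hd x
    have hN := normSq_nonneg x
    by_cases hx : x = 0
    · subst hx
      rw [normSq_zero, zero_add] at h1
      rwa [Set.indicator_of_mem (Set.mem_singleton _), Pi.one_apply, mul_one]
    · rw [Set.indicator_of_notMem (by simpa using hx), mul_zero]
      have : 0 ≤ 101 / 4 * (normSq x + 101) ^ (-(1 / 4) : ℝ) / (normSq x + 101) ^ 2 := by
        positivity
      linarith

/-- The Green function of the simple random walk is finite at the origin. -/
lemma tsum_closed_lt_top (hd : 3 ≤ d) :
    ∑' w : {w : List (Step d) // disp w = 0}, wordWeight w.1 < ∞ := by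
  obtain ⟨C, hC⟩ := exists_green_bound hd
  have h1 : ∑' w : {w : List (Step d) // disp w = 0}, wordWeight w.1 =
      ∑' w : List (Step d), ({0} : Set (ZLat d)).indicator 1 (disp w) * wordWeight w := by
    refine (tsum_subtype {w : List (Step d) | disp w = 0} wordWeight).trans ?_
    refine tsum_congr fun w => ?_
    by_cases hw : disp w = 0
    · simp [Set.indicator, hw]
    · simp [Set.indicator, hw]
  have h2 (k : ℕ) : ∑ u : Fin k → Step d, ({0} : Set (ZLat d)).indicator (1 : ZLat d → ℝ≥0∞)
      (disp (List.ofFn u)) * wordWeight (List.ofFn u) =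
        ENNReal.ofReal (avg^[k] (({0} : Set (ZLat d)).indicator 1) 0) := by
    have hd0 : (d : ℝ) ≠ 0 := by exact_mod_cast (by omega : d ≠ 0)
    have h3 := sum_words (d := d) (by omega) k (({0} : Set (ZLat d)).indicator 1) 0
    have h4 : avg^[k] (({0} : Set (ZLat d)).indicator 1) 0 = ∑ u : Fin k → Step d,
        ({0} : Set (ZLat d)).indicator (1 : ZLat d → ℝ) (disp (List.ofFn u)) *
          (1 / (2 * (d : ℝ))) ^ k := by
      simp only [zero_add] at h3
      rw [← Finset.sum_mul, h3, one_div, inv_pow]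
      field_simp
    rw [h4, ENNReal.ofReal_sum_of_nonneg fun u _ =>
      mul_nonneg (Set.indicator_nonneg (by simp) _) (by positivity)]
    refine Finset.sum_congr rfl fun u _ => ?_
    rw [ENNReal.ofReal_mul (Set.indicator_nonneg (by simp) _),
      ENNReal.ofReal_pow (by positivity), wordWeight, List.length_ofFn]
    congr 1
    by_cases hu : disp (List.ofFn u) = 0 <;> simp [Set.indicator, hu]
  -- Grouping words by length turns the sum into the series of return probabilities.
  rw [h1, ← List.equivSigmaTuple.symm.tsum_eq, ENNReal.tsum_sigma']
  have h5 (k : ℕ) : ∑' u : Fin k → Step d, ({0} : Set (ZLat d)).indicator (1 : ZLat d → ℝ≥0∞)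
      (disp (List.equivSigmaTuple.symm ⟨k, u⟩)) * wordWeight (List.equivSigmaTuple.symm ⟨k, u⟩) =
        ENNReal.ofReal (avg^[k] (({0} : Set (ZLat d)).indicator 1) 0) := by
    rw [tsum_fintype, ← h2]
    rfl
  simp_rw [h5]
  refine lt_of_le_of_lt (b := ENNReal.ofReal C) ?_ ENNReal.ofReal_lt_top
  rw [ENNReal.tsum_eq_iSup_nat]
  refine iSup_le fun k => ?_
  rw [← ENNReal.ofReal_sum_of_nonneg]
  · exact ENNReal.ofReal_le_ofReal (hC k)
  · intro j _
    have := avg_iterate_mono j (f := fun _ => 0) (g := ({0} : Set (ZLat d)).indicator 1)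
      (Set.indicator_nonneg (by simp)) 0
    rwa [avg_iterate_const (by omega)] at this

/-! ### Closed walks that reach distance `n` -/

/-- The opposite step. -/
def Step.flip (s : Step d) : Step d := (s.1, !s.2)

lemma Step.flip_injective : Function.Injective (Step.flip (d := d)) := by
  rintro ⟨i, a⟩ ⟨j, b⟩ h
  simpa [Step.flip] using h

lemma Step.vec_flip (s : Step d) : s.flip.vec = -s.vec := by
  obtain ⟨i, a⟩ := s
  cases a <;> simp [Step.vec, Step.flip, ← Pi.single_neg]

lemma disp_map_flip (w : List (Step d)) : disp (w.map Step.flip) = -disp w := by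
  induction w with
  | nil => simp
  | cons s w ih => simp [ih, Step.vec_flip, add_comm]

/-- Pairs of words of length `k` with a common far away endpoint. -/
abbrev FarPair (d n k : ℕ) : Type :=
  {p : (Fin k → Step d) × (Fin k → Step d) //
    disp (List.ofFn p.1) = disp (List.ofFn p.2) ∧ disp (List.ofFn p.1) ∈ farSet d n}

/-- The first word followed by the flipped second one is closed. The second need not be reversed,
since only its total displacement matters. The total length `2k` and the two halves recover the
pair. -/
lemma sum_card_farPair_le (n : ℕ) (K : Finset ℕ) :
    ∑ k ∈ K, (Nat.card (FarPair d n k) : ℝ≥0∞) * ENNReal.ofReal (1 / (2 * (d : ℝ))) ^ (2 * k) ≤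
      ∑' w : {w : List (Step d) // disp w = 0 ∧ Hits (farSet d n) w}, wordWeight w.1 := by
  classical
  let ψ : (Σ k : K, FarPair d n k) → {w : List (Step d) // disp w = 0 ∧ Hits (farSet d n) w} :=
    fun t => ⟨List.ofFn t.2.1.1 ++ (List.ofFn t.2.1.2).map Step.flip, by
      rw [disp_append, disp_map_flip, t.2.2.1, add_neg_cancel], _, _, rfl, t.2.2.2⟩
  have hψ : Function.Injective ψ := by
    rintro ⟨⟨k, hk⟩, ⟨⟨u, v⟩, hp⟩⟩ ⟨⟨k', hk'⟩, ⟨⟨u', v'⟩, hp'⟩⟩ h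
    have h : List.ofFn u ++ (List.ofFn v).map Step.flip =
      List.ofFn u' ++ (List.ofFn v').map Step.flip := congrArg Subtype.val h
    have hl := congrArg List.length h
    simp only [List.length_append, List.length_map, List.length_ofFn] at hl
    obtain rfl : k = k' := by omega
    obtain ⟨h1, h2⟩ := List.append_inj h (by simp)
    obtain rfl := List.ofFn_injective h1
    obtain rfl := List.ofFn_injective (List.map_injective_iff.2 Step.flip_injective h2)
    rfl
  refine le_trans (le_of_eq ?_) (ENNReal.tsum_comp_le_tsum_of_injective hψ _)
  rw [ENNReal.tsum_sigma', tsum_fintype, Finset.sum_coe_sort K fun k =>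
    ∑' p : FarPair d n k, wordWeight (List.ofFn p.1.1 ++ (List.ofFn p.1.2).map Step.flip)]
  refine Finset.sum_congr rfl fun k _ => ?_
  simp [wordWeight, two_mul, tsum_fintype]

/-- Cauchy–Schwarz over endpoints: at least `(2d)^k / 11` words end in `R`, which has at most
`(13dn)^d` points, and the squared fibre sizes count pairs. -/
lemma farPair_lower_bound (hd : 2 ≤ d) {n k : ℕ} (hn : 1 ≤ n) (h1 : 2 * d * n ^ 2 ≤ k)
    (h2 : k ≤ 4 * d * n ^ 2) :
    (2 * (d : ℝ)) ^ (2 * k) ≤ 121 * (13 * d * n) ^ d * Nat.card (FarPair d n k) := by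
  classical
  have hk : 1 ≤ k := le_trans (Nat.mul_pos (by omega) (pow_pos hn 2)) h1
  have h1' : 2 * (d : ℝ) * n ^ 2 ≤ k := by exact_mod_cast h1
  have h2' : (k : ℝ) ≤ 4 * d * n ^ 2 := by exact_mod_cast h2
  have hd' : (2 : ℝ) ≤ d := by exact_mod_cast hd
  have hn' : (1 : ℝ) ≤ n := by exact_mod_cast hn
  set R := {x : ZLat d | (k : ℝ) / 2 ≤ normSq x ∧ normSq x ≤ 7 * k}
  -- On `R`, `normSq x ≤ 7k ≤ 28dn² ≤ (6dn)²`.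
  let B : Finset (ZLat d) := Fintype.piFinset fun _ => Finset.Icc (-(6 * d * n : ℤ)) (6 * d * n)
  have hRB {x : ZLat d} (hx : x ∈ R) : x ∈ B := by
    refine Fintype.mem_piFinset.2 fun i => ?_
    rw [Finset.mem_Icc, ← abs_le]
    have h3 := (sq_le_normSq x i).trans hx.2
    have h4 : (x i : ℝ) ^ 2 ≤ (6 * d * n) ^ 2 := by nlinarith [sq_nonneg (n : ℝ)]
    have h5 := abs_le_of_sq_le_sq h4 (by positivity)
    exact_mod_cast h5
  -- If all coordinates were below `n` in absolute value, `normSq x < dn² ≤ k/2`; hence the lower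
  -- bound on `k`.
  have hRF {x : ZLat d} (hx : x ∈ R) : x ∈ farSet d n := by
    by_contra hcon
    simp only [farSet, Set.mem_ofPred_eq, not_exists, not_le] at hcon
    have h3 : normSq x < ∑ _i : Fin d, (n : ℝ) ^ 2 := by
      refine Finset.sum_lt_sum_of_nonempty ⟨⟨0, by omega⟩, Finset.mem_univ _⟩ fun i _ => ?_
      exact sq_lt_sq.2 (by rw [abs_of_nonneg (by positivity : (0 : ℝ) ≤ n)]; exact_mod_cast hcon i)
    have h4 := hx.1
    simp only [Finset.sum_const, Finset.card_univ, Fintype.card_fin, nsmul_eq_mul] at h3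
    nlinarith
  let W : Finset (Fin k → Step d) := {u | disp (List.ofFn u) ∈ R}
  have hW : (2 * (d : ℝ)) ^ k ≤ 11 * W.card := by
    have h3 := one_le_avg_iterate_indicator hd hk
    have h4 := sum_words (d := d) (by omega) k (R.indicator 1) 0
    have h5 : ∑ u : Fin k → Step d, R.indicator (1 : ZLat d → ℝ) (0 + disp (List.ofFn u)) =
        W.card := by
      simp only [zero_add, Set.indicator_apply, Pi.one_apply, W]
      rw [Finset.sum_boole]
    rw [h5] at h4
    rw [h4]
    have h6 : 0 < (2 * (d : ℝ)) ^ k := by positivity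
    nlinarith
  have hmaps : Set.MapsTo (fun u : Fin k → Step d => disp (List.ofFn u)) W B := fun u hu =>
    hRB (by simpa [W] using hu)
  have hfib := Finset.card_eq_sum_card_fiberwise hmaps
  have hcs := sq_sum_le_card_mul_sum_sq (s := B)
    (f := fun x => (({u ∈ W | disp (List.ofFn u) = x} : Finset _).card : ℝ))
  have hpairs : ∑ x ∈ B, (({u ∈ W | disp (List.ofFn u) = x} : Finset _).card : ℝ) ^ 2 ≤
      Nat.card (FarPair d n k) := by
    have h3 : Nat.card (FarPair d n k) = (Finset.univ.filter
        fun p : (Fin k → Step d) × (Fin k → Step d) =>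
          disp (List.ofFn p.1) = disp (List.ofFn p.2) ∧
            disp (List.ofFn p.1) ∈ farSet d n).card := by
      rw [Nat.card_eq_fintype_card, Fintype.card_subtype]
    rw [h3]
    have h4 : (B.biUnion fun x => ({u ∈ W | disp (List.ofFn u) = x} : Finset _) ×ˢ
        ({u ∈ W | disp (List.ofFn u) = x} : Finset _)) ⊆ (Finset.univ.filter
        fun p : (Fin k → Step d) × (Fin k → Step d) =>
          disp (List.ofFn p.1) = disp (List.ofFn p.2) ∧
            disp (List.ofFn p.1) ∈ farSet d n) := by
      intro p hp
      simp only [Finset.mem_biUnion, Finset.mem_product, Finset.mem_filter] at hp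
      obtain ⟨x, -, ⟨hu, rfl⟩, ⟨-, hv⟩⟩ := hp
      simp only [Finset.mem_filter, Finset.mem_univ, true_and]
      exact ⟨hv.symm, hRF (by simpa [W] using hu)⟩
    have h5 := Finset.card_le_card h4
    rw [Finset.card_biUnion] at h5
    · simp only [Finset.card_product, ← sq] at h5
      exact_mod_cast h5
    · intro x _ y _ hxy
      refine Finset.disjoint_left.2 fun p hp hq => hxy ?_
      simp only [Finset.mem_product, Finset.mem_filter] at hp hq
      exact hp.1.2.symm.trans hq.1.2
  have hB : (B.card : ℝ) ≤ (13 * d * n) ^ d := by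
    have h3 : B.card = (12 * d * n + 1) ^ d := by
      simp only [B, Fintype.card_piFinset, Int.card_Icc, Finset.prod_const, Finset.card_univ,
        Fintype.card_fin]
      congr 1
      zify
      have : (0 : ℤ) ≤ 6 * d * n := by positivity
      rw [Int.toNat_of_nonneg (by linarith)]
      ring
    rw [h3]
    push_cast
    gcongr
    nlinarith
  have hfib' : (W.card : ℝ) = ∑ x ∈ B, (({u ∈ W | disp (List.ofFn u) = x} : Finset _).card : ℝ) := by
    exact_mod_cast hfib
  rw [← hfib'] at hcs
  calc (2 * (d : ℝ)) ^ (2 * k) = ((2 * (d : ℝ)) ^ k) ^ 2 := by rw [mul_comm 2 k, pow_mul]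
    _ ≤ (11 * W.card) ^ 2 := by gcongr
    _ = 121 * (W.card : ℝ) ^ 2 := by ring
    _ ≤ 121 * ((13 * d * n) ^ d * Nat.card (FarPair d n k)) := by
        gcongr
        exact hcs.trans (mul_le_mul hB hpairs (Finset.sum_nonneg fun _ _ => sq_nonneg _)
          (by positivity))
    _ = _ := by ring

lemma exists_closed_hits_lower_bound (hd : 2 ≤ d) : ∃ c : ℝ, 0 < c ∧ ∀ n : ℕ, 1 ≤ n →
    ENNReal.ofReal (c * (n : ℝ) ^ (2 - (d : ℤ))) ≤
      ∑' w : {w : List (Step d) // disp w = 0 ∧ Hits (farSet d n) w}, wordWeight w.1 := by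
  have hd' : (2 : ℝ) ≤ d := by exact_mod_cast hd
  refine ⟨2 * d / (121 * (13 * d) ^ d), by positivity, fun n hn => ?_⟩
  have hn' : (1 : ℝ) ≤ n := by exact_mod_cast hn
  refine le_trans ?_ (sum_card_farPair_le n (Finset.Icc (2 * d * n ^ 2) (4 * d * n ^ 2)))
  have hterm (k : ℕ) (hk : k ∈ Finset.Icc (2 * d * n ^ 2) (4 * d * n ^ 2)) :
      ENNReal.ofReal (1 / (121 * (13 * d * n) ^ d)) ≤
        (Nat.card (FarPair d n k) : ℝ≥0∞) * ENNReal.ofReal (1 / (2 * (d : ℝ))) ^ (2 * k) := by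
    obtain ⟨h1, h2⟩ := Finset.mem_Icc.1 hk
    have h3 := farPair_lower_bound hd hn h1 h2
    rw [← ENNReal.ofReal_pow (by positivity), ← ENNReal.ofReal_natCast,
      ← ENNReal.ofReal_mul (by positivity)]
    refine ENNReal.ofReal_le_ofReal ?_
    rw [div_pow, one_pow, mul_one_div, div_le_div_iff₀ (by positivity) (by positivity)]
    linarith
  refine le_trans ?_ (Finset.sum_le_sum hterm)
  rw [Finset.sum_const, nsmul_eq_mul, Nat.card_Icc, ← ENNReal.ofReal_natCast,
    ← ENNReal.ofReal_mul (by positivity)]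
  refine ENNReal.ofReal_le_ofReal ?_
  have hcard : 2 * (d : ℝ) * n ^ 2 ≤ ((4 * d * n ^ 2 + 1 - 2 * d * n ^ 2 : ℕ) : ℝ) := by
    have : 2 * d * n ^ 2 ≤ 4 * d * n ^ 2 + 1 - 2 * d * n ^ 2 := by
      have : 4 * d * n ^ 2 = 2 * d * n ^ 2 + 2 * d * n ^ 2 := by ring
      omega
    exact_mod_cast this
  refine le_trans (le_of_eq ?_) (mul_le_mul_of_nonneg_right hcard (by positivity))
  rw [zpow_sub₀ (by positivity), mul_pow _ (n : ℝ), zpow_natCast]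
  field_simp

/-- The loop measure of the loops crossing from `0` to the boundary of the box of radius `n` is
at least of order `n ^ (2 - d)`. -/
lemma exists_loopMeasure_lower_bound (hd : 3 ≤ d) : ∃ c : ℝ, 0 < c ∧ ∀ n : ℕ, 1 ≤ n →
    ENNReal.ofReal (c * (n : ℝ) ^ (2 - (d : ℤ))) ≤
      loopMeasure (srw d) 0 (crossingLoops d n) := by
  obtain ⟨c, hc, h⟩ := exists_closed_hits_lower_bound (d := d) (by omega)
  have hG := tsum_closed_lt_top hd
  set G := ∑' w : {w : List (Step d) // disp w = 0}, wordWeight w.1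
  -- Adding `1` gives a positive divisor without a lower bound on `G`.
  have hG1 : G ≤ ENNReal.ofReal (G.toReal + 1) := by
    rw [← ENNReal.ofReal_toReal hG.ne]
    exact ENNReal.ofReal_le_ofReal (by simp)
  have hg : 0 < G.toReal + 1 := by positivity
  set g := G.toReal + 1
  refine ⟨c / g ^ 2, by positivity, fun n hn => ?_⟩
  have h0 : (0 : ZLat d) ∉ farSet d n := by
    rintro ⟨i, hi⟩
    simp at hi
    omega
  have h1 := ((h n hn).trans (tsum_closed_hits_le h0)).trans
    (mul_le_mul' (mul_le_mul' hG1 (tsum_excursion_le_loopMeasure hn)) hG1)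
  have h2 : c / g ^ 2 * (n : ℝ) ^ (2 - (d : ℤ)) = c * (n : ℝ) ^ (2 - (d : ℤ)) / g ^ 2 := by ring
  rw [h2, ENNReal.ofReal_div_of_pos (by positivity), ENNReal.ofReal_pow hg.le]
  refine ENNReal.div_le_of_le_mul (h1.trans (le_of_eq ?_))
  ring

end Walk

/-! ### Poisson random measures: probability of a non-empty set -/

lemma pointMeasure_eq_zero_iff {E : Type*} [MeasurableSpace E] (L : Coll E) {A : Set E}
    (hA : MeasurableSet A) : pointMeasure L A = 0 ↔ ∀ x ∈ A, L x = 0 := by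
  rw [pointMeasure, Measure.sum_apply _ hA, ENNReal.tsum_eq_zero]
  refine forall_congr' fun x => ?_
  rw [Measure.smul_apply, Measure.dirac_apply' _ hA, smul_eq_mul]
  by_cases hx : x ∈ A <;> simp [hx]

lemma half_min_one_le_one_sub_exp_neg {t : ℝ} (ht : 0 ≤ t) :
    min 1 t / 2 ≤ 1 - Real.exp (-t) := by
  have h1 : Real.exp (-t) ≤ 1 / (1 + t) := by
    rw [Real.exp_neg, ← one_div]
    exact one_div_le_one_div_of_le (by linarith) (by linarith [Real.add_one_le_exp t])
  have h2 : min 1 t / 2 ≤ 1 - 1 / (1 + t) := by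
    rw [one_sub_div (by linarith), le_div_iff₀ (by linarith)]
    rcases min_cases 1 t with ⟨h, h'⟩ | ⟨h, h'⟩ <;> rw [h] <;> nlinarith
  linarith

section Poisson

variable {Ω E : Type*} [MeasurableSpace Ω] [MeasurableSpace E] {P : Measure Ω}
  {ν : Measure E} {N : Ω → Measure E}

lemma IsPoissonRandomMeasure.measure_eq_zero (h : IsPoissonRandomMeasure P ν N) {A : Set E}
    (hA : MeasurableSet A) (hν : ν A ≠ ∞) :
    P {ω | N ω A = 0} = ENNReal.ofReal (Real.exp (-(ν A).toReal)) := by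
  have hm : Measurable fun ω => N ω A := (Measure.measurable_coe hA).comp h.measurable
  have h1 : P {ω | N ω A = 0} = P.map (fun ω => N ω A) {0} := by
    rw [Measure.map_apply hm (measurableSet_singleton _)]
    rfl
  have h2 : (fun k : ℕ => (k : ℝ≥0∞)) ⁻¹' {0} = {0} := by
    ext k
    simp
  rw [h1, h.count A hA hν, Measure.map_apply measurable_from_top (measurableSet_singleton _), h2,
    poissonMeasure_singleton]
  simp [ENNReal.coe_toNNReal_eq_toReal]

/-- A Poisson random measure charges a set of large intensity with large probability. -/
lemma IsPoissonRandomMeasure.le_measureReal_ne_zero [IsProbabilityMeasure P] (h : IsPoissonRandomMeasure P ν N)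
    {A : Set E} (hA : MeasurableSet A) {t : ℝ} (ht : 0 ≤ t) (hν : ENNReal.ofReal t ≤ ν A) :
    min 1 t / 2 ≤ P.real {ω | N ω A ≠ 0} := by
  have hm : Measurable fun ω => N ω A := (Measure.measurable_coe hA).comp h.measurable
  have hz : MeasurableSet {ω | N ω A = 0} := hm (measurableSet_singleton 0)
  have h1 : P.real {ω | N ω A ≠ 0} = 1 - P.real {ω | N ω A = 0} := probReal_compl_eq_one_sub hz
  by_cases htop : ν A = ∞
  · have h2 : P {ω | N ω A = 0} = 0 := by
      have h3 := h.count_top A hA htop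
      refine measure_mono_null (fun ω (hω : N ω A = 0) => ?_) (ae_iff.1 h3)
      simp only [Set.mem_ofPred_eq, hω]
      exact ENNReal.zero_ne_top
    rw [h1, measureReal_def, h2]
    simp only [ENNReal.toReal_zero, sub_zero]
    linarith [min_le_left 1 t]
  · rw [h1, measureReal_def, h.measure_eq_zero hA htop, ENNReal.toReal_ofReal (Real.exp_pos _).le]
    have h2 : t ≤ (ν A).toReal := by
      rw [← ENNReal.toReal_ofReal ht]
      exact ENNReal.toReal_mono htop hν
    have h3 := half_min_one_le_one_sub_exp_neg (t := (ν A).toReal) ENNReal.toReal_nonneg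
    have h4 : min 1 t ≤ min 1 (ν A).toReal := min_le_min_left _ h2
    linarith

end Poisson

/-! ### Loops of the ensemble run along lattice edges -/

/-- The loops along the edges of `G`. -/
def graphLoops {V : Type*} (G : SimpleGraph V) : Set (DiscreteLoop V) :=
  {ℓ | Cycle.Chain G.Adj ℓ.1}

lemma isChain_of_zipWith_ne_zero {V : Type*} {Q : V → V → ℝ} {x : V} {l : List V} {y : V}
    (h : (List.zipWith Q (x :: l) (l ++ [y])).prod ≠ 0) :
    List.IsChain (fun a b => Q a b ≠ 0) (x :: (l ++ [y])) := by
  induction l generalizing x with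
  | nil => simpa using h
  | cons z l ih =>
    simp only [List.cons_append, List.zipWith_cons_cons, List.prod_cons, mul_ne_zero_iff] at h
    rw [List.cons_append, List.isChain_cons_cons]
    exact ⟨h.1, ih h.2⟩

/-- A `DiscreteLoop` may jump between non-neighbours, but any such jump puts a zero factor in the
weight. -/
lemma loopMeasure_compl_graphLoops (d : ℕ) (κ : ℝ) :
    loopMeasure (srw d) κ (graphLoops (latGraph d))ᶜ = 0 := by
  rw [loopMeasure_apply, ENNReal.tsum_eq_zero]
  intro b
  by_contra hne
  rw [mul_eq_zero, not_or] at hne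
  refine hne.2 (Set.indicator_of_notMem (Set.notMem_compl_iff.2 ?_) _)
  obtain ⟨l, hl⟩ := b
  have hw : basedLoopWeight (srw d) κ l ≠ 0 := fun h => hne.1 (by simp [h])
  cases l with
  | nil => simp at hl
  | cons x l =>
    change Cycle.Chain (latGraph d).Adj ((x :: l : List (ZLat d)) : Cycle (ZLat d))
    rw [Cycle.chain_coe_cons]
    have h := right_ne_zero_of_mul hw
    rw [List.rotate_cons_succ, List.rotate_zero] at h
    refine (isChain_of_zipWith_ne_zero h).imp fun a c hac => ?_
    by_contra hcon
    exact hac (by simp [srw, hcon])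

/-- Rotating by `i` brings the `i`-th consecutive pair, including the wrap-around one, to the front,
as `Traverses` demands. -/
lemma Cycle.Chain.and_exists_coe {V : Type*} {r : V → V → Prop} {c : Cycle V}
    (hc : Cycle.Chain r c) (h2 : 2 ≤ c.length) :
    Cycle.Chain (fun x y => r x y ∧ ∃ l : List V, c = ((x :: y :: l : List V) : Cycle V)) c := by
  induction c using Cycle.induction_on with
  | nil => exact Cycle.Chain.nil _
  | cons a l _ =>
    rw [Cycle.chain_coe_cons, List.isChain_iff_getElem] at hc ⊢
    intro i hi
    refine ⟨hc i hi, ?_⟩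
    simp only [Cycle.length_coe, List.length_cons, List.length_append, List.length_nil] at h2 hi
    have hrot : ((a :: l : List V) : Cycle V) = (((a :: l).rotate i : List V) : Cycle V) :=
      Cycle.coe_eq_coe.2 ⟨i, rfl⟩
    have hlen : ((a :: l).rotate i).length = l.length + 1 := by simp
    have e0 := List.getElem_rotate (a :: l) i 0 (by omega)
    have e1 := List.getElem_rotate (a :: l) i 1 (by omega)
    have h0 : (a :: (l ++ [a]))[i] = (a :: l)[(0 + i) % (a :: l).length]'(Nat.mod_lt _ (by simp)) := by
      have : (0 + i) % (a :: l).length = i := by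
        rw [zero_add]; exact Nat.mod_eq_of_lt (by simp; omega)
      simp only [this, ← List.cons_append]
      rw [List.getElem_append_left]
    have h1 : (a :: (l ++ [a]))[i + 1] =
        (a :: l)[(1 + i) % (a :: l).length]'(Nat.mod_lt _ (by simp)) := by
      rcases Nat.lt_or_ge (i + 1) (l.length + 1) with h | h
      · have : (1 + i) % (a :: l).length = i + 1 := by
          rw [add_comm]; exact Nat.mod_eq_of_lt (by simpa using h)
        simp only [this, ← List.cons_append]
        rw [List.getElem_append_left]
      · have hi' : i = l.length := by omega
        have : (1 + i) % (a :: l).length = 0 := by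
          rw [hi', add_comm, List.length_cons, Nat.mod_self]
        simp only [this, ← List.cons_append]
        rw [List.getElem_append_right (by simp [hi'])]
        simp
    obtain ⟨x, y, l', hm⟩ : ∃ x y l', (a :: l).rotate i = x :: y :: l' := by
      match h : (a :: l).rotate i with
      | [] => simp [h] at hlen
      | [_] =>
        rw [h, List.length_singleton] at hlen
        omega
      | x :: y :: l' => exact ⟨x, y, l', rfl⟩
    rw [h0, h1, ← e0, ← e1, hrot]
    simp only [hm]
    exact ⟨l', rfl⟩

/-- Reachability is transitive, and a cyclic chain of a transitive relation relates all pairs of its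
entries. -/
lemma DiscreteLoop.reachable {V : Type*} {G : SimpleGraph V} {L : Coll (DiscreteLoop V)}
    {ℓ : DiscreteLoop V} (hL : L ℓ ≠ 0) (hG : ℓ ∈ graphLoops G) {x y : V} (hx : ℓ.Visits x)
    (hy : ℓ.Visits y) : (openGraph G L).Reachable x y := by
  have : IsTrans V (openGraph G L).Reachable := ⟨fun _ _ _ => SimpleGraph.Reachable.trans⟩
  have hch : Cycle.Chain (openGraph G L).Reachable ℓ.1 :=
    (Cycle.Chain.and_exists_coe hG ℓ.2.1).imp fun a b ⟨hab, l, hl⟩ =>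
      SimpleGraph.Adj.reachable ⟨hab, ℓ, hL, l, Or.inl hl⟩
  exact Cycle.chain_iff_pairwise.1 hch x hx y hy

section Ensemble

variable {Ω : Type*} [MeasurableSpace Ω] {P : Measure Ω} [IsProbabilityMeasure P] {d : ℕ} {α : ℝ}
  {𝓛 : Ω → Coll (DiscreteLoop (ZLat d))}

lemma IsLoopEnsemble.ae_graphLoops {κ : ℝ} (h : IsLoopEnsemble P d α κ 𝓛) :
    ∀ᵐ ω ∂P, ∀ ℓ, 𝓛 ω ℓ ≠ 0 → ℓ ∈ graphLoops (latGraph d) := by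
  have hA : MeasurableSet (graphLoops (latGraph d))ᶜ := MeasurableSpace.measurableSet_top
  have hm : Measurable fun ω => pointMeasure (𝓛 ω) (graphLoops (latGraph d))ᶜ :=
    (Measure.measurable_coe hA).comp h.measurable
  have h0 : (ENNReal.ofReal α • loopMeasure (srw d) κ) (graphLoops (latGraph d))ᶜ = 0 := by
    simp [loopMeasure_compl_graphLoops]
  have h1 := IsPoissonRandomMeasure.measure_eq_zero h hA (by simp [h0])
  rw [h0] at h1
  have h2 : ∀ᵐ ω ∂P, pointMeasure (𝓛 ω) (graphLoops (latGraph d))ᶜ = 0 := by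
    refine (prob_compl_eq_zero_iff (hm (measurableSet_singleton 0))).2 (h1.trans ?_)
    simp
  filter_upwards [h2] with ω hω ℓ hℓ
  by_contra hcon
  exact hℓ ((pointMeasure_eq_zero_iff _ hA).1 hω ℓ hcon)

lemma IsLoopEnsemble.connectsByOneLoop_le_connects {κ : ℝ} (h : IsLoopEnsemble P d α κ 𝓛)
    (A B : Set (ZLat d)) :
    P.real {ω | ConnectsByOneLoop (𝓛 ω) A B} ≤ P.real {ω | Connects (latGraph d) (𝓛 ω) A B} := by
  refine ENNReal.toReal_mono (measure_ne_top _ _) (measure_mono_ae ?_)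
  filter_upwards [h.ae_graphLoops] with ω hω
  rintro ⟨ℓ, hℓ, ⟨x, hx, hxℓ⟩, y, hy, hyℓ⟩
  exact ⟨x, hx, y, hy, DiscreteLoop.reachable hℓ (hω ℓ hℓ) hxℓ hyℓ⟩

lemma connectsByOneLoop_iff (L : Coll (DiscreteLoop (ZLat d))) (n : ℕ) :
    ConnectsByOneLoop L {0} (vertexBoundary (latGraph d) (box 0 n)) ↔
      pointMeasure L (crossingLoops d n) ≠ 0 := by
  rw [Ne, pointMeasure_eq_zero_iff L MeasurableSpace.measurableSet_top]
  push Not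
  refine exists_congr fun ℓ => ?_
  simp only [Set.mem_singleton_iff, exists_eq_left]
  exact and_comm

end Ensemble

theorem theorem1p2 (d : ℕ) (hd : 3 ≤ d) :
    ∃ c : ℝ, 0 < c ∧
      ∀ (α : ℝ), 0 < α →
      ∀ {Ω : Type*} [MeasurableSpace Ω] (P : Measure Ω) [IsProbabilityMeasure P]
        (𝓛 : Ω → Coll (DiscreteLoop (ZLat d))), IsLoopEnsemble P d α 0 𝓛 →
      ∀ n : ℕ, 1 ≤ n →
        P.real {ω | Connects (latGraph d) (𝓛 ω) {0} (vertexBoundary (latGraph d) (box 0 n))} ≥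
            P.real {ω | ConnectsByOneLoop (𝓛 ω) {0} (vertexBoundary (latGraph d) (box 0 n))} ∧
          P.real {ω | ConnectsByOneLoop (𝓛 ω) {0} (vertexBoundary (latGraph d) (box 0 n))} ≥
            c * min 1 (α * (n : ℝ) ^ (2 - (d : ℤ))) := by
  obtain ⟨c, hc, h⟩ := exists_loopMeasure_lower_bound hd
  -- The `1/2` comes from `1 - exp(-t) ≥ min 1 t / 2`, and `min 1 c` from pulling `c` out of `min 1
  -- (c * _)`.
  refine ⟨min 1 c / 2, by positivity, fun α hα Ω _ P _ 𝓛 h𝓛 n hn =>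
    ⟨h𝓛.connectsByOneLoop_le_connects _ _, ?_⟩⟩
  have ht : 0 ≤ α * (n : ℝ) ^ (2 - (d : ℤ)) := by positivity
  have hν : ENNReal.ofReal (c * (α * (n : ℝ) ^ (2 - (d : ℤ)))) ≤
      (ENNReal.ofReal α • loopMeasure (srw d) 0) (crossingLoops d n) := by
    rw [mul_left_comm, ENNReal.ofReal_mul hα.le, Measure.smul_apply, smul_eq_mul]
    exact mul_le_mul_right (h n hn) _
  have key := IsPoissonRandomMeasure.le_measureReal_ne_zero h𝓛 MeasurableSpace.measurableSet_top
    (mul_nonneg hc.le ht) hν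
  simp_rw [connectsByOneLoop_iff]
  refine le_trans ?_ key
  have h1 : min 1 c * min 1 (α * (n : ℝ) ^ (2 - (d : ℤ))) ≤
      min 1 (c * (α * (n : ℝ) ^ (2 - (d : ℤ)))) := by
    refine le_min (mul_le_one₀ (min_le_left _ _) (le_min zero_le_one ht) (min_le_left _ _)) ?_
    exact mul_le_mul (min_le_right _ _) (min_le_right _ _) (le_min zero_le_one ht) hc.le
  linarith
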